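/- Let $R$ be an irreducible (reduced, crystallographic) root system, $R^+$ a system of positive roots, and $\rho$ the half-sum of the positive roots. For $\alpha\in R$ let $\alpha^\vee$ be its coroot and let $R^\vee$ be the dual root system. A weight of $R$ is a vector on which every coroot takes an integer value. For weights $\mu,\nu$ of $R$ define the Weyl polynomial $$P^R_{\mu,\nu}(x)=\frac{\prod_{\alpha\in R^+}\bigl(\alpha^\vee(\mu)x+\alpha^\vee(\nu+\rho)\bigr)}{\prod_{\alpha\in R^+}\alpha^\vee(\rho)}\in\mathbb{Q}[x].$$ A closed root subsystem of a root system $S$ is a subset $S'\subseteq S$, possibly empty, with $S\cap\operatorname{Span}(S')=S'$ (any such subset is stable under its own reflections); it is proper if $S'\neq S$. For an irreducible root system $S$, the efficiency $\mathrm{eff}(S)$ is the supremum of $\frac{|S'|}{|S|-|S''|}$ over all pairs of disjoint proper closed root subsystems $S',S''$ of $S$, and the level $\mathrm{lev}(S)$ is the smallest value of $|S'^+|=|S'|/2$, the number of positive roots of $S'$, over all such pairs with $\frac{|S'|}{|S|-|S''|}=\mathrm{eff}(S)$. Consider all pairs of weights $\mu,\nu$ of $R$ such that $\alpha^\vee(\mu)\ge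 0$ for all $\alpha\in R^+$, such that $\alpha^\vee(\nu)\ge 0$ for all $\alpha\in R^+$ with $\alpha^\vee(\mu)=0$, and such that $\nu+\rho\neq 0$. For each such pair, $P^R_{\mu,\nu}\neq 0$, and $\deg P^R_{\mu,\nu}=0$ if and only if $\mu=0$. Over all such pairs with $\mu\neq 0$, the maximum of $$\frac{\mathrm{ord}_{x=0}P^R_{\mu,\nu}(x)}{\deg P^R_{\mu,\nu}(x)}$$ exists and equals $\mathrm{eff}(R^\vee)$, and every such pair attaining this maximum satisfies $\mathrm{ord}_{x=0}P^R_{\mu,\nu}(x)\ge\mathrm{lev}(R^\vee)$. -/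

import Mathlib

open Polynomial

noncomputable section

namespace WeylPoly

section

variable {ι M N : Type*} [AddCommGroup M] [Module ℝ M] [AddCommGroup N] [Module ℝ N]

/-- The weight lattice of a root system: the vectors on which every coroot takes an integer
value. -/
def weightLattice (P : RootPairing ι ℝ M N) : AddSubgroup M where
  carrier := {v | ∀ i, ∃ n : ℤ, P.coroot' i v = n}
  zero_mem' := fun i => ⟨0, by simp⟩
  add_mem' := by
    intro v w hv hw i
    obtain ⟨m, hm⟩ := hv i
    obtain ⟨n, hn⟩ := hw i
    exact ⟨m + n, by rw [map_add, hm, hn]; push_cast; rfl⟩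
  neg_mem' := by
    intro v hv i
    obtain ⟨m, hm⟩ := hv i
    exact ⟨-m, by rw [map_neg, hm]; push_cast; rfl⟩

/-- The integer `αᵢ^∨(v)`, for a weight `v` and the coroot `αᵢ^∨` of the root with index `i`. -/
def corootValue {P : RootPairing ι ℝ M N} (i : ι) (v : weightLattice P) : ℤ :=
  Classical.choose (v.2 i)

theorem corootValue_spec {P : RootPairing ι ℝ M N} (i : ι) (v : weightLattice P) :
    (corootValue i v : ℝ) = P.coroot' i (v : M) :=
  (Classical.choose_spec (v.2 i)).symm

end

section

variable {ι M N : Type*} [Fintype ι] [AddCommGroup M] [Module ℝ M] [AddCommGroup N] [Module ℝ N]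
  {P : RootPairing ι ℝ M N}

open Classical in
/-- The set `R⁺` of positive roots (as indices) with respect to a base. -/
def posRoots (b : P.Base) : Finset ι :=
  Finset.univ.filter fun i => b.IsPos i

/-- Half the sum of the positive roots. -/
def halfSum (b : P.Base) : M :=
  (1 / 2 : ℝ) • ∑ i ∈ posRoots b, P.root i

theorem coroot'_halfSum_of_mem_support [P.IsCrystallographic] [P.IsReduced] (b : P.Base) {i : ι}
    (hi : i ∈ b.support) : P.coroot' i (halfSum b) = 1 := by
  classical
  have hpos : i ∈ posRoots b := by
    simp [posRoots, RootPairing.Base.isPos_iff, b.height_one_of_mem_support hi]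
  have hz : ∑ j ∈ (posRoots b).erase i, P.pairing j i = 0 := by
    have key : ∀ j ∈ (posRoots b).erase i, P.reflectionPerm i j ∈ (posRoots b).erase i := by
      intro j hj
      rw [Finset.mem_erase] at hj ⊢
      have hjp : b.IsPos j := by simpa [posRoots] using hj.2
      have hj' : b.IsPos (P.reflectionPerm i j) := hjp.reflectionPerm hi hj.1
      refine ⟨?_, by simpa [posRoots] using hj'⟩
      intro h
      have hji : j = P.reflectionPerm i i := by
        rw [← P.reflectionPerm_self i j, h]
      have h1 : b.height j = - b.height i := by
        rw [hji]; exact b.height_reflectionPerm_self i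
      have h2 := b.height_one_of_mem_support hi
      have h3 : 0 < b.height j := hjp
      omega
    have h : ∑ j ∈ (posRoots b).erase i, P.pairing j i
        = ∑ j ∈ (posRoots b).erase i, - P.pairing j i := by
      refine Finset.sum_nbij' (P.reflectionPerm i) (P.reflectionPerm i) key key ?_ ?_ ?_
      · intro j _; simp
      · intro j _; simp
      · intro j _
        rw [← P.pairing_reflectionPerm_self_right, P.pairing_reflectionPerm]
        simp
    rw [Finset.sum_neg_distrib] at h
    linarith
  have hs : P.coroot' i (halfSum b) = (1 / 2 : ℝ) * ∑ j ∈ posRoots b, P.pairing j i := by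
    rw [halfSum, map_smul, map_sum, smul_eq_mul]
    simp only [RootPairing.root_coroot'_eq_pairing]
  rw [hs, ← Finset.add_sum_erase _ _ hpos, hz, P.pairing_same]
  norm_num

theorem halfSum_mem_weightLattice [P.IsCrystallographic] [P.IsReduced] (b : P.Base) :
    halfSum b ∈ weightLattice P := by
  intro i
  have h : ∀ x ∈ Submodule.span ℤ (P.coroot '' b.support),
      ∃ n : ℤ, P.toLinearMap (halfSum b) x = n := by
    intro x hx
    induction hx using Submodule.span_induction with
    | mem x hx =>
      obtain ⟨j, hj, rfl⟩ := hx
      exact ⟨1, by simpa using coroot'_halfSum_of_mem_support b hj⟩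
    | zero => exact ⟨0, by simp⟩
    | add x y _ _ hx hy =>
      obtain ⟨m, hm⟩ := hx
      obtain ⟨n, hn⟩ := hy
      exact ⟨m + n, by rw [map_add, hm, hn]; push_cast; rfl⟩
    | smul a x _ hx =>
      obtain ⟨m, hm⟩ := hx
      exact ⟨a * m, by rw [map_zsmul, hm, zsmul_eq_mul]; push_cast; rfl⟩
  exact h _ (b.coroot_mem_span_int i)

/-- The half-sum `ρ` of the positive roots, as an element of the weight lattice. -/
def rho [P.IsCrystallographic] [P.IsReduced] (b : P.Base) : weightLattice P :=
  ⟨halfSum b, halfSum_mem_weightLattice b⟩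

/-- The Weyl polynomial
`∏_{α ∈ R⁺} (α^∨(μ) x + α^∨(ν + ρ)) / ∏_{α ∈ R⁺} α^∨(ρ)` in `ℚ[x]`. -/
def weylPolynomial [P.IsCrystallographic] [P.IsReduced] (b : P.Base)
    (μ ν : weightLattice P) : ℚ[X] :=
  C (∏ i ∈ posRoots b, (corootValue i (rho b) : ℚ))⁻¹ *
    ∏ i ∈ posRoots b,
      (C (corootValue i μ : ℚ) * X + C (corootValue i (ν + rho b) : ℚ))

/-- The dominance conditions on a pair of weights: `α^∨(μ) ≥ 0` for every positive root `α`, and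
`α^∨(ν) ≥ 0` for every positive root `α` with `α^∨(μ) = 0`. -/
structure DominancePair (b : P.Base) (μ ν : weightLattice P) : Prop where
  nonneg_left : ∀ i ∈ posRoots b, 0 ≤ corootValue i μ
  nonneg_right : ∀ i ∈ posRoots b, corootValue i μ = 0 → 0 ≤ corootValue i ν

end

section

variable {ι M N : Type*} [AddCommGroup M] [Module ℝ M] [AddCommGroup N] [Module ℝ N]

/-- A proper closed root subsystem of `P`, as a set of root indices: a set of roots, not the whole
root system, that is stable under its own reflections and contains every root lying in its linear
span. (The empty set is allowed.) -/
structure IsProperClosedSubsystem (P : RootPairing ι ℝ M N) (S : Set ι) : Prop where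
  reflectionPerm_mem : ∀ i ∈ S, ∀ j ∈ S, P.reflectionPerm i j ∈ S
  mem_of_root_mem_span : ∀ i, P.root i ∈ Submodule.span ℝ (P.root '' S) → i ∈ S
  ne_univ : S ≠ Set.univ

/-- The quotient `|R'| / (|R| - |R''|)`, the roots of `R` being indexed by `ι`. -/
def subsystemRatio (S' S'' : Set ι) : ℝ :=
  (S'.ncard : ℝ) / ((Nat.card ι : ℝ) - (S''.ncard : ℝ))

/-- The efficiency of a root system `R`: the supremum of `|R'| / (|R| - |R''|)` over disjoint
proper closed root subsystems `R'`, `R''`. -/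
def efficiency (P : RootPairing ι ℝ M N) : ℝ :=
  sSup {r : ℝ | ∃ S' S'' : Set ι, IsProperClosedSubsystem P S' ∧ IsProperClosedSubsystem P S'' ∧
    Disjoint S' S'' ∧ r = subsystemRatio S' S''}

/-- The level of a root system `R`: the smallest number `|R'⁺|` of positive roots of `R'`, over
disjoint proper closed root subsystems `R'`, `R''` such that `|R'| / (|R| - |R''|)` equals the
efficiency. (As `R'` is stable under negation, this number is `|R'| / 2`; it does not depend on the
base that determines the positive roots.) -/
def level [Fintype ι] {P : RootPairing ι ℝ M N} (b : P.Base) : ℕ :=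
  sInf {n : ℕ | ∃ S' S'' : Set ι, IsProperClosedSubsystem P S' ∧ IsProperClosedSubsystem P S'' ∧
    Disjoint S' S'' ∧ subsystemRatio S' S'' = efficiency P ∧
    n = (S' ∩ (posRoots b : Set ι)).ncard}

end

end WeylPoly

end

/-! A factor `a x + c` with `(a, c) ≠ (0, 0)` raises the degree iff `a ≠ 0` and the order at `0` iff
`c = 0`. Dominance excludes `a = c = 0`: where a positive coroot kills `μ`, it is nonnegative on `ν`
and positive on `ρ`. After doubling to include negative coroots, order/degree is therefore the
subsystem ratio of the zero sets of `ν + ρ` and `μ` among the coroots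
(`DominancePair.ratio_eq_subsystemRatio`). These are disjoint proper closed subsystems of the dual,
which gives the upper bound and the level inequality.

Conversely, every closed set of coroots is the zero set of a weight
(`exists_weight_corootValue_eq_zero_iff`). Given disjoint `S'`, `S''` with such weights `v`, `μ`, a
permutation of the coroots makes `μ` dominant and `v` nonnegative where `μ` vanishes
(`exists_conj_dominant_pair`); by disjointness `v ≥ 1` there. Then `ν = n v - ρ` with `n` large
realises the ratio. The supremum is attained since there are finitely many subsystems. -/

namespace WeylPoly

/-! ### Degree and order at zero of products of linear factors -/

section PolynomialCounts

variable {ι K : Type*} [Field K]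

theorem C_mul_X_add_C_ne_zero {a c : K} (h : a ≠ 0 ∨ c ≠ 0) : C a * X + C c ≠ 0 := by
  intro h0
  have h1 := congrArg (fun p => coeff p 1) h0
  have h2 := congrArg (fun p => coeff p 0) h0
  simp at h1 h2
  simp_all

theorem rootMultiplicity_zero_C_mul_X_add_C [DecidableEq K] {a c : K} (h : a ≠ 0 ∨ c ≠ 0) :
    (C a * X + C c).rootMultiplicity 0 = if c = 0 then 1 else 0 := by
  split_ifs with hc
  · subst hc
    have ha : a ≠ 0 := by simpa using h
    have hX : (X : K[X]).rootMultiplicity 0 = 1 := by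
      simpa using rootMultiplicity_X_sub_C_self (x := (0 : K))
    rw [C_0, add_zero, rootMultiplicity_mul (mul_ne_zero (by simpa using ha) X_ne_zero),
      rootMultiplicity_C, hX]
  · exact rootMultiplicity_eq_zero (by simpa using hc)

theorem natDegree_C_mul_X_add_C [DecidableEq K] (a c : K) :
    (C a * X + C c).natDegree = if a = 0 then 0 else 1 := by
  split_ifs with ha
  · simp [ha]
  · exact natDegree_linear ha

theorem natDegree_prod_C_mul_X_add_C [DecidableEq K] (s : Finset ι) (a c : ι → K)
    (h : ∀ i ∈ s, a i ≠ 0 ∨ c i ≠ 0) :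
    (∏ i ∈ s, (C (a i) * X + C (c i))).natDegree = (s.filter fun i => a i ≠ 0).card := by
  rw [natDegree_prod _ _ fun i hi => C_mul_X_add_C_ne_zero (h i hi), Finset.card_filter]
  refine Finset.sum_congr rfl fun i _ => ?_
  rw [natDegree_C_mul_X_add_C, ite_not]

theorem rootMultiplicity_zero_prod_C_mul_X_add_C [DecidableEq K] (s : Finset ι) (a c : ι → K)
    (h : ∀ i ∈ s, a i ≠ 0 ∨ c i ≠ 0) :
    (∏ i ∈ s, (C (a i) * X + C (c i))).rootMultiplicity 0
      = (s.filter fun i => c i = 0).card := by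
  classical
  induction s using Finset.induction_on with
  | empty => simp
  | insert i s hi ih =>
    have hs : ∀ j ∈ s, a j ≠ 0 ∨ c j ≠ 0 := fun j hj => h j (Finset.mem_insert_of_mem hj)
    have hi' := h i (Finset.mem_insert_self i s)
    rw [Finset.prod_insert hi, rootMultiplicity_mul (mul_ne_zero (C_mul_X_add_C_ne_zero hi')
      (Finset.prod_ne_zero_iff.2 fun j hj => C_mul_X_add_C_ne_zero (hs j hj))), ih hs,
      rootMultiplicity_zero_C_mul_X_add_C hi', Finset.filter_insert]
    split_ifs
    · rw [Finset.card_insert_of_notMem (by simp [hi]), add_comm]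
    · rw [zero_add]

end PolynomialCounts

/-! ### Zero sets of weights as closed subsystems of the dual -/

section CorootValues

variable {ι M N : Type*} [AddCommGroup M] [Module ℝ M] [AddCommGroup N] [Module ℝ N]
  {P : RootPairing ι ℝ M N}

theorem corootValue_eq_iff {i : ι} {v : weightLattice P} {n : ℤ} :
    corootValue i v = n ↔ P.coroot' i (v : M) = n := by
  rw [← corootValue_spec, Int.cast_inj]

@[simp] theorem corootValue_add (i : ι) (v w : weightLattice P) :
    corootValue i (v + w) = corootValue i v + corootValue i w := by
  rw [corootValue_eq_iff]
  push_cast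
  rw [map_add, corootValue_spec, corootValue_spec]

@[simp] theorem corootValue_zero (i : ι) : corootValue i (0 : weightLattice P) = 0 := by
  rw [corootValue_eq_iff]
  simp

@[simp] theorem corootValue_sub (i : ι) (v w : weightLattice P) :
    corootValue i (v - w) = corootValue i v - corootValue i w := by
  rw [corootValue_eq_iff]
  push_cast
  rw [map_sub, corootValue_spec, corootValue_spec]

@[simp] theorem corootValue_nsmul (i : ι) (n : ℕ) (v : weightLattice P) :
    corootValue i (n • v) = n * corootValue i v := by
  rw [corootValue_eq_iff]
  push_cast
  rw [map_nsmul, corootValue_spec, nsmul_eq_mul]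

@[simp] theorem corootValue_reflectionPerm_self (i : ι) (v : weightLattice P) :
    corootValue (P.reflectionPerm i i) v = - corootValue i v := by
  rw [corootValue_eq_iff, RootPairing.coroot'_reflectionPerm]
  simp [corootValue_spec, RootPairing.reflection_apply]
  ring

theorem eq_zero_of_forall_corootValue_eq_zero [P.IsRootSystem] {v : weightLattice P}
    (h : ∀ i, corootValue i v = 0) : v = 0 := by
  have h' : P.toLinearMap (v : M) = 0 := by
    refine LinearMap.ext_on_range (RootPairing.IsRootSystem.span_coroot_eq_top (P := P)) fun i => ?_
    simpa using (corootValue_eq_iff (n := 0)).1 (h i)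
  exact Subtype.ext (P.toPerfPair.injective (by simpa using h'))

/-- The kernel of a linear functional contains the span of any coroots in it; it cannot contain all
coroots, because they span. -/
theorem isProperClosedSubsystem_corootValue_eq_zero [P.IsRootSystem] {v : weightLattice P}
    (hv : v ≠ 0) : IsProperClosedSubsystem P.flip {i | corootValue i v = 0} := by
  have closed : ∀ i, P.coroot i ∈ Submodule.span ℝ (P.coroot '' {i | corootValue i v = 0}) →
      corootValue i v = 0 := by
    intro i hi
    have hle : Submodule.span ℝ (P.coroot '' {i | corootValue i v = 0})
        ≤ LinearMap.ker (P.toLinearMap (v : M)) := by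
      rw [Submodule.span_le]
      rintro _ ⟨j, hj, rfl⟩
      simpa using (corootValue_eq_iff (n := 0)).1 hj
    rw [corootValue_eq_iff]
    simpa using hle hi
  refine ⟨fun i hi j hj => closed _ ?_, closed, fun h => hv ?_⟩
  · change P.coroot (P.reflectionPerm i j) ∈ _
    rw [RootPairing.coroot_reflectionPerm, RootPairing.coreflection_apply]
    exact Submodule.sub_mem _ (Submodule.subset_span ⟨j, hj, rfl⟩)
      (Submodule.smul_mem _ _ (Submodule.subset_span ⟨i, hi, rfl⟩))
  · exact eq_zero_of_forall_corootValue_eq_zero fun i => (h ▸ Set.mem_univ i :)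

end CorootValues

/-! ### Positive roots, positive coroots and `ρ` -/

section Positivity

variable {ι M N : Type*} [Fintype ι] [AddCommGroup M] [Module ℝ M] [AddCommGroup N] [Module ℝ N]
  {P : RootPairing ι ℝ M N}

theorem mem_posRoots {b : P.Base} {i : ι} : i ∈ posRoots b ↔ b.IsPos i := by
  simp [posRoots]

omit [Fintype ι] in
theorem isPos_reflectionPerm_self_iff (b : P.Base) (i : ι) :
    b.IsPos (P.reflectionPerm i i) ↔ ¬ b.IsPos i :=
  RootPairing.Base.IsPos.neg_iff_not b i

/-- Positive roots arise from simple ones by simple reflections. These permute the indices in the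
same way for `P` and its dual, and in both a simple reflection keeps every positive index positive
except its own. -/
theorem isPos_flip_of_isPos [P.IsCrystallographic] [P.IsReduced] {b : P.Base} {i : ι}
    (hi : b.IsPos i) : b.flip.IsPos i := by
  refine hi.induction_on_reflect (p := fun k => b.IsPos k → b.flip.IsPos k)
    (fun k hk _ => RootPairing.Base.isPos_of_mem_support (b := b.flip) hk) ?_ hi
  intro k j hk hj hkj
  by_cases hjj : P.reflectionPerm j k = j
  · rw [hjj]
    exact RootPairing.Base.isPos_of_mem_support (b := b.flip) hj
  · have hpos : b.IsPos k := by simpa using hkj.reflectionPerm hj hjj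
    have hne : k ≠ j := by
      rintro rfl
      exact (isPos_reflectionPerm_self_iff b k).1 hkj hpos
    exact (hk hpos).reflectionPerm hj hne

theorem isPos_flip_iff [P.IsCrystallographic] [P.IsReduced] {b : P.Base} {i : ι} :
    b.flip.IsPos i ↔ b.IsPos i :=
  ⟨fun h => isPos_flip_of_isPos h, isPos_flip_of_isPos⟩

theorem posRoots_flip [P.IsCrystallographic] [P.IsReduced] (b : P.Base) :
    posRoots b.flip = posRoots b := by
  ext i
  rw [mem_posRoots, mem_posRoots, isPos_flip_iff]

/-- Every positive coroot is a sum of simple coroots. -/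
theorem coroot_induction [P.IsCrystallographic] [P.IsReduced] {b : P.Base} {p : ι → Prop}
    (simple : ∀ i ∈ b.support, p i)
    (add : ∀ i j k, P.coroot k = P.coroot i + P.coroot j → p i → j ∈ b.support → p k)
    {i : ι} (hi : b.IsPos i) : p i :=
  (isPos_flip_of_isPos hi).induction_on_add simple add

theorem coroot'_nonneg_of_forall_support [P.IsCrystallographic] [P.IsReduced] {b : P.Base} {x : M}
    (h : ∀ i ∈ b.support, 0 ≤ P.coroot' i x) {i : ι} (hi : b.IsPos i) : 0 ≤ P.coroot' i x := by
  refine coroot_induction h ?_ hi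
  intro i j k hk hi hj
  have : P.coroot' k x = P.coroot' i x + P.coroot' j x := by simp [hk]
  rw [this]
  exact add_nonneg hi (h j hj)

theorem corootValue_rho_pos [P.IsCrystallographic] [P.IsReduced] {b : P.Base} {i : ι}
    (hi : b.IsPos i) : 0 < corootValue i (rho b) := by
  have : 0 < P.coroot' i (halfSum b) := by
    refine coroot_induction (p := fun j => 0 < P.coroot' j (halfSum b))
      (fun j hj => by rw [coroot'_halfSum_of_mem_support b hj]; exact one_pos) ?_ hi
    intro i j k hk hi hj
    have h : P.coroot' k (halfSum b) = P.coroot' i (halfSum b) + P.coroot' j (halfSum b) := by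
      simp [hk]
    rw [h, coroot'_halfSum_of_mem_support b hj]
    linarith
  rw [← Int.cast_pos (R := ℝ), corootValue_spec]
  exact this

/-- A set of roots stable under negation has twice as many elements as positive elements. -/
theorem ncard_eq_two_mul_card_filter (b : P.Base) (p : ι → Prop) [DecidablePred p]
    (hp : ∀ i, p (P.reflectionPerm i i) ↔ p i) :
    {i | p i}.ncard = 2 * ((posRoots b).filter p).card := by
  classical
  let := P.indexNeg
  have h1 : {i | p i} = ((Finset.univ.filter p : Finset ι) : Set ι) := by ext; simp
  have h2 : ((Finset.univ.filter p).filter fun i => ¬ b.IsPos i).card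
      = ((posRoots b).filter p).card := by
    refine Finset.card_bij' (fun i _ => -i) (fun i _ => -i) ?_ ?_
      (fun i _ => neg_neg i) (fun i _ => neg_neg i)
    · intro i hi
      simp only [Finset.mem_filter, Finset.mem_univ, true_and] at hi
      rw [Finset.mem_filter, mem_posRoots]
      exact ⟨(isPos_reflectionPerm_self_iff b i).2 hi.2, (hp i).2 hi.1⟩
    · intro i hi
      rw [Finset.mem_filter, mem_posRoots] at hi
      simp only [Finset.mem_filter, Finset.mem_univ, true_and]
      exact ⟨(hp i).2 hi.2, fun h => (isPos_reflectionPerm_self_iff b i).1 h hi.1⟩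
  have h3 : (Finset.univ.filter p).filter (fun i => b.IsPos i) = (posRoots b).filter p := by
    ext i
    simp [mem_posRoots, and_comm]
  rw [h1, Set.ncard_coe_finset, ← Finset.card_filter_add_card_filter_not (fun i => b.IsPos i),
    h2, h3, two_mul]

end Positivity

/-! ### Closed sets of coroots are zero sets of weights -/

section RationalPoints

variable {ι M N : Type*} [Fintype ι] [AddCommGroup M] [Module ℝ M] [AddCommGroup N] [Module ℝ N]
  {P : RootPairing ι ℝ M N}

/-- An additive functional on the coroot space with rational values at the coroots agrees, on
coroots, with evaluation at a vector. -/
theorem exists_forall_coroot'_eq [P.IsCrystallographic] [P.IsReduced] [P.IsRootSystem]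
    (b : P.Base) (f : N →+ ℝ) : ∃ x : M, ∀ i, P.coroot' i x = f (P.coroot i) := by
  -- As `f` is only additive, it is matched on simple coroots and extended `ℝ`-linearly; integrality
  -- of coroots in the base then gives agreement on all of them.
  refine ⟨P.toPerfPair.symm (b.toCoweightBasis.constr ℝ fun j => f (P.coroot j)), fun i => ?_⟩
  set x := P.toPerfPair.symm (b.toCoweightBasis.constr ℝ fun j => f (P.coroot j)) with hx
  have key : ∀ y : N, P.toLinearMap x y
      = b.toCoweightBasis.constr ℝ (fun j => f (P.coroot j)) y := by
    intro y
    change P.toPerfPair x y = _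
    rw [hx, LinearEquiv.apply_symm_apply]
  have simple : ∀ j ∈ b.support, P.coroot' j x = f (P.coroot j) := by
    intro j hj
    have := key (b.toCoweightBasis ⟨j, hj⟩)
    rw [Module.Basis.constr_basis] at this
    simpa using this
  refine b.flip.induction_add i (p := fun i => P.coroot' i x = f (P.coroot i)) ?_ simple ?_
  · intro i hi
    change P.coroot' (P.reflectionPerm i i) x = f (P.coroot (P.reflectionPerm i i))
    simp at hi ⊢
    exact hi
  · intro i j k hk hi hj
    have hk' : P.coroot k = P.coroot i + P.coroot j := hk
    have hj' := simple j hj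
    simp only [LinearMap.flip_apply] at hi hj' ⊢
    rw [hk', map_add, map_add, hi, hj']

/-- A closed set of coroots is the set of coroots vanishing at some weight. -/
theorem exists_weight_corootValue_eq_zero_iff [P.IsCrystallographic] [P.IsReduced]
    [P.IsRootSystem] (b : P.Base) {S : Set ι}
    (hS : ∀ i, P.coroot i ∈ Submodule.span ℝ (P.coroot '' S) → i ∈ S) :
    ∃ v : weightLattice P, ∀ i, corootValue i v = 0 ↔ i ∈ S := by
  -- Working over `ℚ` gives rational values on coroots, so that a multiple of the functional is a
  -- weight. The `ℚ`-span lies in the `ℝ`-span, so closedness still applies.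
  let : Module ℚ N := Module.compHom N (algebraMap ℚ ℝ)
  have : IsScalarTower ℚ ℝ N := ⟨fun q r x => by
    rw [Algebra.smul_def, mul_smul]; rfl⟩
  set V := Submodule.span ℚ (P.coroot '' S) with hV
  have hVS : ∀ i : {i // i ∉ S}, V.mkQ (P.coroot i) ≠ 0 := by
    intro i hi
    rw [Submodule.mkQ_apply, Submodule.Quotient.mk_eq_zero] at hi
    exact i.2 (hS i (Submodule.span_le_restrictScalars ℚ ℝ _ hi))
  -- One functional on the quotient by `V` avoids zero at the finitely many coroots outside `S`.
  obtain ⟨φ, hφ⟩ := Module.exists_dual_forall_apply_ne_zero (K := ℚ) _ hVS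
  set q : ι → ℚ := fun i => φ (V.mkQ (P.coroot i)) with hq
  have hq0 : ∀ i, q i = 0 ↔ i ∈ S := by
    intro i
    refine ⟨fun h => by_contra fun hi => hφ ⟨i, hi⟩ h, fun hi => ?_⟩
    have : V.mkQ (P.coroot i) = 0 := by
      rw [Submodule.mkQ_apply, Submodule.Quotient.mk_eq_zero]
      exact Submodule.subset_span ⟨i, hi, rfl⟩
    simp only [hq, this, map_zero]
  obtain ⟨x, hx⟩ := exists_forall_coroot'_eq b
    ((Rat.castHom ℝ).toAddMonoidHom.comp (φ ∘ₗ V.mkQ).toAddMonoidHom)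
  have hx' : ∀ i, P.coroot' i x = (q i : ℝ) := fun i => hx i
  obtain ⟨d, hd⟩ := IsLocalization.exist_integer_multiples_of_finite (nonZeroDivisors ℤ) q
  choose n hn using hd
  have hd0 : ((d : ℤ) : ℝ) ≠ 0 := by
    exact_mod_cast nonZeroDivisors.coe_ne_zero d
  have hdx : ∀ i, P.coroot' i (((d : ℤ) : ℝ) • x) = n i := by
    intro i
    have h := hn i
    rw [Algebra.smul_def] at h
    have h' : ((n i : ℤ) : ℚ) = ((d : ℤ) : ℚ) * q i := by simpa using h
    rw [map_smul, hx', smul_eq_mul]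
    exact_mod_cast h'.symm
  refine ⟨⟨((d : ℤ) : ℝ) • x, fun i => ⟨n i, hdx i⟩⟩, fun i => ?_⟩
  rw [← hq0, corootValue_eq_iff, map_smul, hx']
  simp [hd0]

end RationalPoints
-- Conjugation into the dominant chamber
section Dominance

variable {ι M N : Type*} [Fintype ι] [AddCommGroup M] [Module ℝ M] [AddCommGroup N] [Module ℝ N]
  {P : RootPairing ι ℝ M N}

/-- A simple reflection changes the sum of the positive coroots by twice the simple coroot. -/
theorem sum_posRoots_reflectionPerm [P.IsCrystallographic] [P.IsReduced] {b : P.Base} {j : ι}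
    (hj : j ∈ b.support) (y : M) :
    ∑ i ∈ posRoots b, P.coroot' (P.reflectionPerm j i) y
      = (∑ i ∈ posRoots b, P.coroot' i y) - 2 * P.coroot' j y := by
  classical
  have hjp : j ∈ posRoots b := mem_posRoots.2 (RootPairing.Base.isPos_of_mem_support hj)
  have hmaps : ∀ i ∈ (posRoots b).erase j, P.reflectionPerm j i ∈ (posRoots b).erase j := by
    intro i hi
    rw [Finset.mem_erase, mem_posRoots] at hi ⊢
    refine ⟨fun h => ?_, hi.2.reflectionPerm hj hi.1⟩
    have : i = P.reflectionPerm j j := by rw [← P.reflectionPerm_self j i, h]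
    exact (isPos_reflectionPerm_self_iff b j).1 (this ▸ hi.2)
      (RootPairing.Base.isPos_of_mem_support hj)
  have hsum : ∑ i ∈ (posRoots b).erase j, P.coroot' (P.reflectionPerm j i) y
      = ∑ i ∈ (posRoots b).erase j, P.coroot' i y :=
    Finset.sum_nbij' (P.reflectionPerm j) (P.reflectionPerm j) hmaps hmaps
      (by simp) (by simp) (by simp)
  have hself : P.coroot' (P.reflectionPerm j j) y = - P.coroot' j y := by simp
  rw [← Finset.add_sum_erase _ _ hjp, ← Finset.add_sum_erase _ (fun i => P.coroot' i y) hjp, hsum,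
    hself]
  ring

/-- Every vector is conjugate to a dominant one; the conjugating map permutes the coroots. -/
theorem exists_conj_dominant [P.IsCrystallographic] [P.IsReduced] (b : P.Base) (z : M) :
    ∃ (e : Equiv.Perm ι) (g : M →ₗ[ℝ] M), (∀ i x, P.coroot' i (g x) = P.coroot' (e i) x) ∧
      ∀ i ∈ posRoots b, 0 ≤ P.coroot' i (g z) := by
  classical
  let T : Set (Equiv.Perm ι) :=
    {e | ∃ g : M →ₗ[ℝ] M, ∀ i x, P.coroot' i (g x) = P.coroot' (e i) x}
  -- Were a simple coroot negative at the maximiser, its reflection would increase the sum.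
  obtain ⟨e, ⟨g, hg⟩, hmax⟩ := T.exists_max_image
    (fun e => ∑ i ∈ posRoots b, P.coroot' (e i) z) T.toFinite ⟨1, LinearMap.id, fun _ _ => rfl⟩
  refine ⟨e, g, hg, fun i hi => coroot'_nonneg_of_forall_support (b := b) ?_ (mem_posRoots.1 hi)⟩
  intro j hj
  have hT : e * P.reflectionPerm j ∈ T := by
    refine ⟨(P.reflection j : M →ₗ[ℝ] M) ∘ₗ g, fun i x => ?_⟩
    rw [Equiv.Perm.mul_apply, ← hg, RootPairing.coroot'_reflectionPerm]
    rfl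
  have hle := hmax _ hT
  simp only [Equiv.Perm.mul_apply, ← hg] at hle
  rw [sum_posRoots_reflectionPerm hj] at hle
  linarith

/-- Every pair of weights is conjugate to one whose first member is dominant and whose second member
is nonnegative on the positive coroots annihilating the first. -/
theorem exists_conj_dominant_pair [P.IsCrystallographic] [P.IsReduced] (b : P.Base)
    (μ v : weightLattice P) :
    ∃ (e : Equiv.Perm ι) (μ' v' : weightLattice P),
      (∀ i, corootValue i μ' = corootValue (e i) μ) ∧
      (∀ i, corootValue i v' = corootValue (e i) v) ∧
      ∀ i ∈ posRoots b, 0 ≤ corootValue i μ' ∧ (corootValue i μ' = 0 → 0 ≤ corootValue i v') := by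
  -- Since `n` exceeds all values of `v` and values are integers, dominance of `n μ + v` is
  -- lexicographic: the sign of `μ` decides, then that of `v`.
  set n : ℕ := ∑ i, (corootValue i v).natAbs + 1 with hn
  obtain ⟨e, g, hg, hpos⟩ := exists_conj_dominant b ((n • μ + v : weightLattice P) : M)
  have conj : ∀ w : weightLattice P, ∃ w' : weightLattice P,
      ∀ i, corootValue i w' = corootValue (e i) w := by
    intro w
    have hw : ∀ i, P.coroot' i (g w) = corootValue (e i) w := fun i => by
      rw [hg, corootValue_spec]
    exact ⟨⟨g w, fun i => ⟨_, hw i⟩⟩, fun i => corootValue_eq_iff.2 (hw i)⟩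
  obtain ⟨μ', hμ'⟩ := conj μ
  obtain ⟨v', hv'⟩ := conj v
  refine ⟨e, μ', v', hμ', hv', fun i hi => ?_⟩
  have h0 : 0 ≤ (n : ℤ) * corootValue (e i) μ + corootValue (e i) v := by
    have h := hpos i hi
    rw [hg, ← corootValue_spec, corootValue_add, corootValue_nsmul] at h
    exact_mod_cast h
  have hlt : (corootValue (e i) v).natAbs < n := Nat.lt_succ_of_le
    (Finset.single_le_sum (f := fun i => (corootValue i v).natAbs) (fun _ _ => Nat.zero_le _)
      (Finset.mem_univ (e i)))
  have hlt' : corootValue (e i) v < n := by omega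
  rw [hμ', hv']
  refine ⟨?_, fun h => by simpa [h] using h0⟩
  by_contra! hneg
  nlinarith

end Dominance

/-! ### Weyl polynomials and pairs of subsystems -/

section WeylPolynomial

variable {ι M N : Type*} [Fintype ι] [AddCommGroup M] [Module ℝ M] [AddCommGroup N] [Module ℝ N]
  {P : RootPairing ι ℝ M N}

theorem DominancePair.corootValue_ne_zero_or [P.IsCrystallographic] [P.IsReduced] {b : P.Base}
    {μ ν : weightLattice P} (h : DominancePair b μ ν) {i : ι} (hi : i ∈ posRoots b) :
    corootValue i μ ≠ 0 ∨ corootValue i (ν + rho b) ≠ 0 := by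
  refine or_iff_not_imp_left.2 fun hμ => ?_
  have h1 := h.nonneg_right i hi (not_not.1 hμ)
  have h2 := corootValue_rho_pos (mem_posRoots.1 hi)
  rw [corootValue_add]
  omega

theorem prod_corootValue_rho_ne_zero [P.IsCrystallographic] [P.IsReduced] (b : P.Base) :
    (∏ i ∈ posRoots b, (corootValue i (rho b) : ℚ))⁻¹ ≠ 0 := by
  refine inv_ne_zero (Finset.prod_ne_zero_iff.2 fun i hi => ?_)
  exact_mod_cast (corootValue_rho_pos (mem_posRoots.1 hi)).ne'

theorem DominancePair.weylPolynomial_ne_zero [P.IsCrystallographic] [P.IsReduced] {b : P.Base}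
    {μ ν : weightLattice P} (h : DominancePair b μ ν) : weylPolynomial b μ ν ≠ 0 := by
  refine mul_ne_zero (C_ne_zero.2 (prod_corootValue_rho_ne_zero b))
    (Finset.prod_ne_zero_iff.2 fun i hi => C_mul_X_add_C_ne_zero ?_)
  exact_mod_cast h.corootValue_ne_zero_or hi

theorem DominancePair.natDegree_weylPolynomial [P.IsCrystallographic] [P.IsReduced] {b : P.Base}
    {μ ν : weightLattice P} (h : DominancePair b μ ν) :
    (weylPolynomial b μ ν).natDegree
      = ((posRoots b).filter fun i => corootValue i μ ≠ 0).card := by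
  rw [weylPolynomial, natDegree_C_mul (prod_corootValue_rho_ne_zero b),
    natDegree_prod_C_mul_X_add_C _ (fun i => (corootValue i μ : ℚ))
      (fun i => (corootValue i (ν + rho b) : ℚ))
      (fun i hi => by exact_mod_cast h.corootValue_ne_zero_or hi)]
  congr 1
  ext i
  simp

theorem DominancePair.rootMultiplicity_weylPolynomial [P.IsCrystallographic] [P.IsReduced]
    {b : P.Base} {μ ν : weightLattice P} (h : DominancePair b μ ν) :
    (weylPolynomial b μ ν).rootMultiplicity 0
      = ((posRoots b).filter fun i => corootValue i (ν + rho b) = 0).card := by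
  rw [weylPolynomial, rootMultiplicity_mul h.weylPolynomial_ne_zero, rootMultiplicity_C, zero_add,
    rootMultiplicity_zero_prod_C_mul_X_add_C _ (fun i => (corootValue i μ : ℚ))
      (fun i => (corootValue i (ν + rho b) : ℚ))
      (fun i hi => by exact_mod_cast h.corootValue_ne_zero_or hi)]
  congr 1
  ext i
  simp [-corootValue_add]

theorem ncard_corootValue_eq_zero (b : P.Base) (v : weightLattice P) :
    {i | corootValue i v = 0}.ncard
      = 2 * ((posRoots b).filter fun i => corootValue i v = 0).card :=
  ncard_eq_two_mul_card_filter b _ fun i => by simp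

theorem card_eq_two_mul_card_posRoots (b : P.Base) : Nat.card ι = 2 * (posRoots b).card := by
  have h := ncard_eq_two_mul_card_filter b (fun _ => True) (by simp)
  simpa [Set.ncard_univ] using h

theorem DominancePair.ratio_eq_subsystemRatio [P.IsCrystallographic] [P.IsReduced]
    {b : P.Base} {μ ν : weightLattice P} (h : DominancePair b μ ν) :
    ((weylPolynomial b μ ν).rootMultiplicity 0 : ℝ) / ((weylPolynomial b μ ν).natDegree : ℝ)
      = subsystemRatio {i | corootValue i (ν + rho b) = 0} {i | corootValue i μ = 0} := by
  have hd := Finset.card_filter_add_card_filter_not (s := posRoots b)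
    (fun i => corootValue i μ = 0)
  rw [h.natDegree_weylPolynomial, h.rootMultiplicity_weylPolynomial, subsystemRatio,
    ncard_corootValue_eq_zero b, ncard_corootValue_eq_zero b, card_eq_two_mul_card_posRoots b, ← hd]
  push_cast
  rw [mul_add, add_sub_cancel_left, mul_div_mul_left _ _ two_ne_zero]

theorem DominancePair.disjoint [P.IsCrystallographic] [P.IsReduced]
    {b : P.Base} {μ ν : weightLattice P} (h : DominancePair b μ ν) :
    Disjoint {i | corootValue i (ν + rho b) = 0} {i | corootValue i μ = 0} := by
  refine Set.disjoint_left.2 fun i h1 h2 => ?_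
  simp only [Set.mem_ofPred_eq] at h1 h2
  by_cases hi : b.IsPos i
  · exact (h.corootValue_ne_zero_or (mem_posRoots.2 hi)).elim (· h2) (· h1)
  · refine (h.corootValue_ne_zero_or
      (mem_posRoots.2 ((isPos_reflectionPerm_self_iff b i).2 hi))).elim (· ?_) (· ?_)
    · simpa using h2
    · rw [corootValue_reflectionPerm_self, h1, neg_zero]

theorem DominancePair.natDegree_eq_zero_iff [P.IsCrystallographic] [P.IsReduced] [P.IsRootSystem]
    {b : P.Base} {μ ν : weightLattice P} (h : DominancePair b μ ν) :
    (weylPolynomial b μ ν).natDegree = 0 ↔ μ = 0 := by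
  rw [h.natDegree_weylPolynomial, Finset.card_eq_zero, Finset.filter_eq_empty_iff]
  refine ⟨fun h0 => eq_zero_of_forall_corootValue_eq_zero fun i => ?_, fun h0 => by simp [h0]⟩
  by_cases hi : b.IsPos i
  · exact not_not.1 (h0 (mem_posRoots.2 hi))
  · have := h0 (mem_posRoots.2 ((isPos_reflectionPerm_self_iff b i).2 hi))
    simpa using this

omit [Fintype ι] in
theorem ncard_preimage_perm (e : Equiv.Perm ι) (S : Set ι) : (e ⁻¹' S).ncard = S.ncard :=
  Set.ncard_preimage_of_injective_subset_range e.injective (by simp)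

/-- Every pair of disjoint proper closed subsystems of the dual system is realised, up to
conjugation, by a dominance pair of weights. -/
theorem exists_dominancePair_subsystemRatio [P.IsCrystallographic] [P.IsReduced] [P.IsRootSystem]
    (b : P.Base) {S' S'' : Set ι} (h' : IsProperClosedSubsystem P.flip S')
    (h'' : IsProperClosedSubsystem P.flip S'') (hd : Disjoint S' S'') :
    ∃ μ ν : weightLattice P, DominancePair b μ ν ∧ ν + rho b ≠ 0 ∧ μ ≠ 0 ∧
      ((weylPolynomial b μ ν).rootMultiplicity 0 : ℝ) / ((weylPolynomial b μ ν).natDegree : ℝ)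
        = subsystemRatio S' S'' := by
  obtain ⟨v₀, hv₀⟩ := exists_weight_corootValue_eq_zero_iff b h'.mem_of_root_mem_span
  obtain ⟨μ₀, hμ₀⟩ := exists_weight_corootValue_eq_zero_iff b h''.mem_of_root_mem_span
  obtain ⟨e, μ, v, hμ, hv, hpos⟩ := exists_conj_dominant_pair b μ₀ v₀
  -- Large enough that `n v - ρ ≥ 0` wherever `v ≥ 1`; the `+ 1` keeps `n ≠ 0`, so `n v` and `v`
  -- have the same zeros.
  set n : ℕ := ∑ i, (corootValue i (rho b)).natAbs + 1 with hn
  have hnρ : ∀ i, corootValue i (rho b) ≤ n := by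
    intro i
    have : (corootValue i (rho b)).natAbs < n := Nat.lt_succ_of_le
      (Finset.single_le_sum (f := fun i => (corootValue i (rho b)).natAbs)
        (fun _ _ => Nat.zero_le _) (Finset.mem_univ i))
    omega
  have hμS : {i | corootValue i μ = 0} = e ⁻¹' S'' := by
    ext i
    simp [hμ, hμ₀]
  have hvS : {i | corootValue i (n • v - rho b + rho b) = 0} = e ⁻¹' S' := by
    ext i
    simp [hv, hv₀]
  have ne_zero : ∀ {S : Set ι} {w : weightLattice P}, S ≠ Set.univ →
      {i | corootValue i w = 0} = e ⁻¹' S → w ≠ 0 := by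
    rintro S _ hS hw rfl
    refine hS (Set.eq_univ_of_forall fun i => ?_)
    have : e.symm i ∈ e ⁻¹' S := hw ▸ corootValue_zero _
    simpa using this
  have hdom : DominancePair b μ (n • v - rho b) := by
    refine ⟨fun i hi => (hpos i hi).1, fun i hi h0 => ?_⟩
    have hne : corootValue i v ≠ 0 := by
      rw [hv]
      intro h
      exact Set.disjoint_left.1 hd ((hv₀ _).1 h) ((hμ₀ _).1 (by rw [← hμ, h0]))
    have h1 := (hpos i hi).2 h0
    have h2 : 1 ≤ corootValue i v := by omega
    rw [corootValue_sub, corootValue_nsmul]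
    nlinarith [hnρ i]
  refine ⟨μ, n • v - rho b, hdom, ne_zero h'.ne_univ hvS, ne_zero h''.ne_univ hμS, ?_⟩
  rw [hdom.ratio_eq_subsystemRatio, hμS, hvS, subsystemRatio, subsystemRatio,
    ncard_preimage_perm, ncard_preimage_perm]

end WeylPolynomial

/-! ### Attainment of the efficiency -/

section Efficiency

variable {ι M N : Type*} [Finite ι] [AddCommGroup M] [Module ℝ M] [AddCommGroup N] [Module ℝ N]
  (P : RootPairing ι ℝ M N)

omit [Finite ι] in
theorem isProperClosedSubsystem_empty [Nonempty ι] : IsProperClosedSubsystem P ∅ :=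
  ⟨by simp, fun i hi => by simp [P.ne_zero i] at hi, Set.empty_ne_univ⟩

/-- The efficiency of a root system is attained. -/
theorem isGreatest_efficiency [Nonempty ι] :
    IsGreatest {r : ℝ | ∃ S' S'' : Set ι, IsProperClosedSubsystem P S' ∧
      IsProperClosedSubsystem P S'' ∧ Disjoint S' S'' ∧ r = subsystemRatio S' S''}
      (efficiency P) := by
  have hfin : {r : ℝ | ∃ S' S'' : Set ι, IsProperClosedSubsystem P S' ∧
      IsProperClosedSubsystem P S'' ∧ Disjoint S' S'' ∧ r = subsystemRatio S' S''}.Finite := by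
    refine (Set.finite_range fun p : Set ι × Set ι => subsystemRatio p.1 p.2).subset ?_
    rintro _ ⟨S', S'', -, -, -, rfl⟩
    exact ⟨(S', S''), rfl⟩
  have hne : {r : ℝ | ∃ S' S'' : Set ι, IsProperClosedSubsystem P S' ∧
      IsProperClosedSubsystem P S'' ∧ Disjoint S' S'' ∧ r = subsystemRatio S' S''}.Nonempty :=
    ⟨_, ∅, ∅, isProperClosedSubsystem_empty P, isProperClosedSubsystem_empty P,
      Set.disjoint_empty _, rfl⟩
  exact ⟨hne.csSup_mem hfin, fun r hr => le_csSup hfin.bddAbove hr⟩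

end Efficiency
end WeylPoly

theorem proposition3p2 {ι M N : Type*} [Fintype ι] [AddCommGroup M] [Module ℝ M]
    [AddCommGroup N] [Module ℝ N] (P : RootPairing ι ℝ M N) [P.IsRootSystem]
    [P.IsCrystallographic] [P.IsReduced] [P.IsIrreducible] (b : P.Base) :
    (∀ μ ν : WeylPoly.weightLattice P, WeylPoly.DominancePair b μ ν → ν + WeylPoly.rho b ≠ 0 →
      WeylPoly.weylPolynomial b μ ν ≠ 0 ∧
      ((WeylPoly.weylPolynomial b μ ν).natDegree = 0 ↔ μ = 0)) ∧
    IsGreatest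
      {r : ℝ | ∃ μ ν : WeylPoly.weightLattice P, WeylPoly.DominancePair b μ ν ∧
        ν + WeylPoly.rho b ≠ 0 ∧ μ ≠ 0 ∧
        r = ((WeylPoly.weylPolynomial b μ ν).rootMultiplicity 0 : ℝ) /
          ((WeylPoly.weylPolynomial b μ ν).natDegree : ℝ)}
      (WeylPoly.efficiency P.flip) ∧
    ∀ μ ν : WeylPoly.weightLattice P, WeylPoly.DominancePair b μ ν →
      ν + WeylPoly.rho b ≠ 0 → μ ≠ 0 →
      ((WeylPoly.weylPolynomial b μ ν).rootMultiplicity 0 : ℝ) /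
          ((WeylPoly.weylPolynomial b μ ν).natDegree : ℝ) = WeylPoly.efficiency P.flip →
      WeylPoly.level b.flip ≤ (WeylPoly.weylPolynomial b μ ν).rootMultiplicity 0 := by
  classical
  have : Nonempty ι := by
    have := RootPairing.IsIrreducible.nontrivial P
    by_contra hι
    rw [not_nonempty_iff] at hι
    have h := RootPairing.IsRootSystem.span_root_eq_top (P := P)
    rw [Set.range_eq_empty, Submodule.span_empty] at h
    exact bot_ne_top h
  refine ⟨fun μ ν h _ => ⟨h.weylPolynomial_ne_zero, h.natDegree_eq_zero_iff⟩, ⟨?_, ?_⟩, ?_⟩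
  · obtain ⟨S', S'', h', h'', hd, hr⟩ := (WeylPoly.isGreatest_efficiency P.flip).1
    obtain ⟨μ, ν, h, hν, hμ, hr'⟩ := WeylPoly.exists_dominancePair_subsystemRatio b h' h'' hd
    exact ⟨μ, ν, h, hν, hμ, hr.trans hr'.symm⟩
  · rintro _ ⟨μ, ν, h, hν, hμ, rfl⟩
    exact (WeylPoly.isGreatest_efficiency P.flip).2
      ⟨_, _, WeylPoly.isProperClosedSubsystem_corootValue_eq_zero hν,
        WeylPoly.isProperClosedSubsystem_corootValue_eq_zero hμ, h.disjoint,
        h.ratio_eq_subsystemRatio⟩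
  · intro μ ν h hν hμ hr
    refine Nat.sInf_le ⟨_, _, WeylPoly.isProperClosedSubsystem_corootValue_eq_zero hν,
      WeylPoly.isProperClosedSubsystem_corootValue_eq_zero hμ, h.disjoint,
      h.ratio_eq_subsystemRatio ▸ hr, ?_⟩
    rw [h.rootMultiplicity_weylPolynomial, WeylPoly.posRoots_flip, ← Set.ncard_coe_finset]
    congr 1
    ext i
    simp [and_comm]
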